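/- Let $M$ be a finite-dimensional smooth manifold (without boundary). A \emph{Poisson tensor} on $M$ is a smooth bivector field $\Pi$ such that the bracket $\{f,g\}=\Pi(df,dg)$ on $C^\infty(M)$ satisfies the Jacobi identity; its bundle map $\Pi^\sharp:T^*M\to TM$ is given by $\beta(\Pi^\sharp(\alpha))=\Pi(\alpha,\beta)$. The triple $(M,\Pi,D)$ is an \emph{exact Poisson manifold} if $\Pi$ is a Poisson tensor and $D$ is a smooth vector field with $\mathcal L_D\Pi=-\Pi$. A symplectic manifold $(M,\omega)$ (that is, $\omega$ is a smooth closed nondegenerate $2$-form) is \emph{exact symplectic} if there is a smooth $1$-form $\theta$ on $M$ with $\omega=-d\theta$. \textbf{Lemma.} Let $(M,\Pi,D)$ be an exact Poisson manifold and assume that $\Pi$ is nondegenerate (at each point, $\Pi(\alpha,\cdot)=0$ implies $\alpha=0$). Then there is a unique $2$-form $\omega$ on $M$ associated with $\Pi$, i.e. such that the bundle map $\omega^\flat:TM\to T^*M$, $\omega^\flat(X)=\omega(X,\cdot)$, and $\Pi^\sharp$ are inverse to each other. This $\omega$ satisfies $\mathcal L_D\omega=\omega$, and $(M,\omega)$ is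 an exact symplectic manifold; in particular $\omega$ is smooth, closed and nondegenerate. -/

import Mathlib

open scoped Manifold ContDiff

noncomputable section

namespace ExactPoisson

section Fields

variable {E : Type*} [NormedAddCommGroup E] [NormedSpace ℝ E]
  {H : Type*} [TopologicalSpace H] (I : ModelWithCorners ℝ E H)
  (M : Type*) [TopologicalSpace M] [ChartedSpace H M]

/-- The cotangent space `T*ₓM`. -/
abbrev CotangentSpace {M : Type*} [TopologicalSpace M] [ChartedSpace H M] (x : M) : Type _ :=
  TangentSpace I x →L[ℝ] ℝ

/-- (Not necessarily continuous) vector fields on `M`. -/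
abbrev VField : Type _ := (x : M) → TangentSpace I x

/-- (Not necessarily continuous) differential `k`-forms on `M`: an alternating `k`-linear form on
each tangent space. -/
abbrev DForm (k : ℕ) : Type _ := (x : M) → (TangentSpace I x) [⋀^Fin k]→L[ℝ] ℝ

/-- (Not necessarily continuous) bivector fields on `M`: an alternating bilinear form on each
cotangent space. -/
abbrev Bivector : Type _ := (x : M) → (CotangentSpace I x) [⋀^Fin 2]→L[ℝ] ℝ

end Fields

section Charts

variable {E : Type*} [NormedAddCommGroup E] [NormedSpace ℝ E]
  {H : Type*} [TopologicalSpace H] (I : ModelWithCorners ℝ E H)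
  {M : Type*} [TopologicalSpace M] [ChartedSpace H M]

/-- The differential at `x` of the chart `φ = extChartAt I x₀`, a linear map `TₓM → E`. -/
def chartDeriv (x₀ x : M) : TangentSpace I x →L[ℝ] E :=
  mfderiv I 𝓘(ℝ, E) (extChartAt I x₀) x

/-- The differential at `y : E` of the inverse of the chart `φ = extChartAt I x₀`, a linear map
from `E` to the tangent space at `φ⁻¹ y`. -/
def chartSymmDeriv (x₀ : M) (y : E) : E →L[ℝ] TangentSpace I ((extChartAt I x₀).symm y) :=
  mfderiv 𝓘(ℝ, E) I (extChartAt I x₀).symm y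

/-- The expression `φ_* V` of a vector field in the chart `φ = extChartAt I x₀`
(meaningful on the target of the chart). -/
def vfieldInChart (V : VField I M) (x₀ : M) (y : E) : E :=
  chartDeriv I x₀ ((extChartAt I x₀).symm y) (V ((extChartAt I x₀).symm y))

/-- The expression `(φ⁻¹)^* η` of a `k`-form in the chart `φ = extChartAt I x₀`. -/
def formInChart {k : ℕ} (η : DForm I M k) (x₀ : M) (y : E) : E [⋀^Fin k]→L[ℝ] ℝ :=
  (η ((extChartAt I x₀).symm y)).compContinuousLinearMap (chartSymmDeriv I x₀ y)

/-- The expression `φ_* P` of a bivector field in the chart `φ = extChartAt I x₀`: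
`(φ_* P)_y (α, β) = P_x (α ∘ dφ_x, β ∘ dφ_x)`, where `x = φ⁻¹ y`. -/
def bivectorInChart (P : Bivector I M) (x₀ : M) (y : E) : (E →L[ℝ] ℝ) [⋀^Fin 2]→L[ℝ] ℝ :=
  (P ((extChartAt I x₀).symm y)).compContinuousLinearMap
    (ContinuousLinearMap.precomp ℝ (chartDeriv I x₀ ((extChartAt I x₀).symm y)))

/-- Smooth vector fields. -/
def SmoothVField [IsManifold I ∞ M] (V : VField I M) : Prop :=
  ContMDiff I I.tangent ∞ (fun x ↦ (⟨x, V x⟩ : TangentBundle I M))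

/-- A differential form is smooth if its coefficients in every chart of the manifold structure
(of the form `extChartAt I x₀`) are smooth. -/
def SmoothForm {k : ℕ} (η : DForm I M k) : Prop :=
  ∀ x₀ : M, ContDiffOn ℝ ∞ (formInChart I η x₀) (extChartAt I x₀).target

/-- A bivector field is smooth if its coefficients in every chart of the manifold structure
(of the form `extChartAt I x₀`) are smooth. -/
def SmoothBivector (P : Bivector I M) : Prop :=
  ∀ x₀ : M, ContDiffOn ℝ ∞ (bivectorInChart I P x₀) (extChartAt I x₀).target

/-- The exterior derivative of a `k`-form; at `x` it is computed in the chart at `x`. -/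
def dExt {k : ℕ} (η : DForm I M k) : DForm I M (k + 1) := fun x ↦
  (extDeriv (formInChart I η x) (extChartAt I x x)).compContinuousLinearMap (chartDeriv I x x)

/-- The Lie derivative of a `k`-form along a vector field, evaluated on `k` tangent vectors at `x`.
In the chart `φ` at `x`, with `V` also denoting the expression of the vector field and `u i` those
of the tangent vectors, it is given by
`(L_V η)(u₀, …) = (D_V η)(u₀, …) + ∑ i, η(u₀, …, DV(u i), …)`. -/
def lieDerivForm {k : ℕ} (V : VField I M) (η : DForm I M k) (x : M)
    (v : Fin k → TangentSpace I x) : ℝ :=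
  let y : E := extChartAt I x x
  let u : Fin k → E := fun i ↦ chartDeriv I x x (v i)
  let V' : E → E := vfieldInChart I V x
  let η' : E → E [⋀^Fin k]→L[ℝ] ℝ := formInChart I η x
  fderiv ℝ η' y (V' y) u + ∑ i, η' y (Function.update u i (fderiv ℝ V' y (u i)))

/-- The expression `α ∘ (dφₓ)⁻¹` of a covector at `x` in the chart `φ` at `x`. -/
def covectorInChart (x : M) (α : CotangentSpace I x) : E →L[ℝ] ℝ :=
  α.comp (chartDeriv I x x).inverse

/-- The Lie derivative of a bivector field along a vector field, evaluated on two covectors at `x`.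
In the chart `φ` at `x`, with `V` also denoting the expression of the vector field and so on, it is
`(L_V P)(α, β) = (D_V P)(α, β) - P(α ∘ DV, β) - P(α, β ∘ DV)`. -/
def lieDerivBivector (V : VField I M) (P : Bivector I M) (x : M)
    (α β : CotangentSpace I x) : ℝ :=
  let y : E := extChartAt I x x
  let a : E →L[ℝ] ℝ := covectorInChart I x α
  let b : E →L[ℝ] ℝ := covectorInChart I x β
  let V' : E → E := vfieldInChart I V x
  let P' : E → (E →L[ℝ] ℝ) [⋀^Fin 2]→L[ℝ] ℝ := bivectorInChart I P x
  fderiv ℝ P' y (V' y) ![a, b]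
    - P' y ![a.comp (fderiv ℝ V' y), b] - P' y ![a, b.comp (fderiv ℝ V' y)]

end Charts

section Poisson

variable {E : Type*} [NormedAddCommGroup E] [NormedSpace ℝ E]
  {H : Type*} [TopologicalSpace H] (I : ModelWithCorners ℝ E H)
  {M : Type*} [TopologicalSpace M] [ChartedSpace H M]

/-- The differential `dfₓ` of a real function, as a covector. -/
def differential (f : M → ℝ) (x : M) : CotangentSpace I x :=
  mfderiv I 𝓘(ℝ, ℝ) f x

/-- The bracket `{f, g} = P(df, dg)`. -/
def bracket (P : Bivector I M) (f g : M → ℝ) (x : M) : ℝ :=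
  P x ![differential I f x, differential I g x]

/-- Poisson tensors: smooth bivector fields whose bracket on `C^∞(M)` satisfies the Jacobi
identity. -/
structure IsPoisson (P : Bivector I M) : Prop where
  smooth : SmoothBivector I P
  jacobi : ∀ f g h : M → ℝ, ContMDiff I 𝓘(ℝ, ℝ) ∞ f → ContMDiff I 𝓘(ℝ, ℝ) ∞ g →
    ContMDiff I 𝓘(ℝ, ℝ) ∞ h → ∀ x : M,
      bracket I P f (bracket I P g h) x + bracket I P g (bracket I P h f) x
        + bracket I P h (bracket I P f g) x = 0

/-- `(M, P, D)` is an exact Poisson manifold: `P` is a Poisson tensor and `D` is a smooth vector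
field with `L_D P = -P`. -/
structure IsExactPoisson [IsManifold I ∞ M] (P : Bivector I M) (D : VField I M) : Prop where
  poisson : IsPoisson I P
  smooth : SmoothVField I D
  lieDeriv : ∀ (x : M) (α β : CotangentSpace I x),
    lieDerivBivector I D P x α β = -P x ![α, β]

/-- A basis of the tangent space at `x`, which is the model space `E` as a vector space. -/
def tangentBasis [FiniteDimensional ℝ E] (x : M) :
    Module.Basis (Fin (Module.finrank ℝ E)) ℝ (TangentSpace I x) :=
  Module.finBasis ℝ E

/-- The dual basis of the cotangent space at `x`. -/
def tangentCoord [FiniteDimensional ℝ E] (x : M) (i : Fin (Module.finrank ℝ E)) :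
    CotangentSpace I x :=
  (LinearMap.toContinuousLinearMap ((Module.finBasis ℝ E).coord i) : E →L[ℝ] ℝ)

theorem tangentCoord_apply [FiniteDimensional ℝ E] (x : M) (i : Fin (Module.finrank ℝ E))
    (v : TangentSpace I x) : tangentCoord I x i v = (tangentBasis I x).repr v i := rfl

/-- The bundle map `P♯ : T*M → TM`, `P♯ α = P(α, ·)`. Here `P(α, ·)`, a linear form on `T*ₓM`, is
regarded as a tangent vector by finite-dimensional biduality, written out in a basis; see
`apply_sharp` for the characterization `β (P♯ α) = P(α, β)` for all `β`. -/
def sharp [FiniteDimensional ℝ E] (P : Bivector I M) (x : M) (α : CotangentSpace I x) :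
    TangentSpace I x :=
  ∑ i, P x ![α, tangentCoord I x i] • tangentBasis I x i

/-- The bundle map `σ♭ : TM → T*M`, `σ♭ v = σ(v, ·)`. -/
def flat (σ : DForm I M 2) (x : M) (v : TangentSpace I x) : CotangentSpace I x :=
  (σ x).toContinuousMultilinearMap.toContinuousLinearMap ![v, 0] 1

theorem flat_apply (σ : DForm I M 2) (x : M) (v w : TangentSpace I x) :
    flat I σ x v w = σ x ![v, w] := by
  have h : Function.update ![v, 0] 1 w = ![v, w] := by
    ext i; fin_cases i <;> simp
  simp [flat, ContinuousMultilinearMap.toContinuousLinearMap, h]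

theorem apply_sharp [FiniteDimensional ℝ E] (P : Bivector I M) (x : M)
    (α β : CotangentSpace I x) : β (sharp I P x α) = P x ![α, β] := by
  let L : CotangentSpace I x →ₗ[ℝ] ℝ :=
    (P x).toAlternatingMap.toMultilinearMap.toLinearMap ![α, 0] 1
  have hu (γ : CotangentSpace I x) : Function.update ![α, 0] 1 γ = ![α, γ] := by
    ext1 i; fin_cases i <;> simp
  have hL (γ : CotangentSpace I x) : L γ = P x ![α, γ] := by
    change P x (Function.update ![α, 0] 1 γ) = _
    rw [hu]
  have hβ : β = ∑ i, β (tangentBasis I x i) • tangentCoord I x i := by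
    ext v
    conv_lhs => rw [← (tangentBasis I x).sum_repr v, map_sum]
    simp only [map_smul, smul_eq_mul, sum_apply, smul_apply,
      tangentCoord_apply, mul_comm]
  have h1 : P x ![α, β] = ∑ i, β (tangentBasis I x i) * P x ![α, tangentCoord I x i] := by
    rw [← hL]
    conv_lhs => rw [hβ, map_sum]
    exact Finset.sum_congr rfl fun i _ ↦ by rw [map_smul, smul_eq_mul, hL]
  rw [h1, sharp, map_sum]
  exact Finset.sum_congr rfl fun i _ ↦ by rw [map_smul, smul_eq_mul, mul_comm]

/-- `P` is nondegenerate: at each point, `P(α, ·) = 0` only for `α = 0`. -/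
def BivectorNondegenerate (P : Bivector I M) : Prop :=
  ∀ (x : M) (α : CotangentSpace I x), (∀ β : CotangentSpace I x, P x ![α, β] = 0) → α = 0

/-- The `2`-form `σ` is the one associated with the bivector field `P`: the bundle maps `P♯` and
`σ♭` are inverse to each other. -/
structure IsAssociated [FiniteDimensional ℝ E] (P : Bivector I M) (σ : DForm I M 2) : Prop where
  flat_sharp : ∀ (x : M) (α : CotangentSpace I x), flat I σ x (sharp I P x α) = α
  sharp_flat : ∀ (x : M) (v : TangentSpace I x), sharp I P x (flat I σ x v) = v

/-- Symplectic forms: smooth, closed, nondegenerate `2`-forms. -/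
structure IsSymplectic (σ : DForm I M 2) : Prop where
  smooth : SmoothForm I σ
  closed : dExt I σ = 0
  nondegenerate : ∀ (x : M) (v : TangentSpace I x), (∀ w : TangentSpace I x, σ x ![v, w] = 0) → v = 0

/-- `(M, σ)` is an exact symplectic manifold: `σ` is symplectic and `σ = -dθ` for some smooth
`1`-form `θ`. -/
structure IsExactSymplectic (σ : DForm I M 2) : Prop where
  symplectic : IsSymplectic I σ
  exact : ∃ θ : DForm I M 1, SmoothForm I θ ∧ σ = -dExt I θ

end Poisson

end ExactPoisson
end

noncomputable section
namespace ExactPoisson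

section LinearAlgebra

variable {E : Type*} [NormedAddCommGroup E] [NormedSpace ℝ E]

/-- Interior multiplication `w ↦ (u ↦ w(u, ·))` on alternating `2`-forms. -/
def interiorL (E : Type*) [NormedAddCommGroup E] [NormedSpace ℝ E] :
    (E [⋀^Fin 2]→L[ℝ] ℝ) →L[ℝ] (E →L[ℝ] E →L[ℝ] ℝ) :=
  (ContinuousLinearMap.compL ℝ E (E [⋀^Fin 1]→L[ℝ] ℝ) (E →L[ℝ] ℝ)
    (ContinuousAlternatingMap.ofSubsingletonLIE (𝕜 := ℝ) (E := E) (F := ℝ)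
      (0 : Fin 1)).symm.toContinuousLinearEquiv.toContinuousLinearMap) ∘L
    (ContinuousAlternatingMap.curryLeftLI (𝕜 := ℝ) (E := E) (F := ℝ)
      (n := 1)).toContinuousLinearMap

theorem interiorL_apply (w : E [⋀^Fin 2]→L[ℝ] ℝ) (u v : E) : interiorL E w u v = w ![u, v] := by
  change w (Matrix.vecCons u _) = _
  congr 1
  ext i
  fin_cases i <;> rfl

theorem apply_swap (w : E [⋀^Fin 2]→L[ℝ] ℝ) (u v : E) : w ![v, u] = -w ![u, v] := by
  have h := w.toAlternatingMap.map_swap ![u, v] (i := 0) (j := 1) (by decide)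
  have hs : ![u, v] ∘ Equiv.swap (0 : Fin 2) 1 = ![v, u] := by
    ext i
    fin_cases i <;> simp
  rw [hs] at h
  exact h

/-- The antisymmetrization of a bilinear form, normalized to fix the alternating ones. -/
def alternatizationL (E : Type*) [NormedAddCommGroup E] [NormedSpace ℝ E] :
    (E →L[ℝ] E →L[ℝ] ℝ) →L[ℝ] (E [⋀^Fin 2]→L[ℝ] ℝ) :=
  (1 / 2 : ℝ) • (ContinuousAlternatingMap.alternatizeUncurryFinCLM ℝ E ℝ (n := 1) ∘L
    ContinuousLinearMap.compL ℝ E (E →L[ℝ] ℝ) (E [⋀^Fin 1]→L[ℝ] ℝ)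
      (ContinuousAlternatingMap.ofSubsingletonLIE (𝕜 := ℝ) (E := E) (F := ℝ)
        (0 : Fin 1)).toContinuousLinearEquiv.toContinuousLinearMap)

theorem alternatizationL_apply (B : E →L[ℝ] E →L[ℝ] ℝ) (u v : E) :
    alternatizationL E B ![u, v] = (1 / 2) * (B u v - B v u) := by
  simp [alternatizationL, ContinuousAlternatingMap.alternatizeUncurryFinCLM_apply,
    ContinuousAlternatingMap.alternatizeUncurryFin_apply, Fin.sum_univ_two, Fin.removeNth,
    sub_eq_add_neg]

theorem alternating_ext {w w' : E [⋀^Fin 2]→L[ℝ] ℝ} (h : ∀ u v, w ![u, v] = w' ![u, v]) :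
    w = w' := by
  ext v
  have hv : v = ![v 0, v 1] := by
    ext i
    fin_cases i <;> rfl
  rw [hv, h]

theorem alternatizationL_interiorL (w : E [⋀^Fin 2]→L[ℝ] ℝ) :
    alternatizationL E (interiorL E w) = w := by
  refine alternating_ext fun u v ↦ ?_
  rw [alternatizationL_apply, interiorL_apply, interiorL_apply, apply_swap w u v]
  ring

variable [FiniteDimensional ℝ E]

/-- The inverse of the canonical map from a finite-dimensional space to its bidual. -/
def bidualL (E : Type*) [NormedAddCommGroup E] [NormedSpace ℝ E] [FiniteDimensional ℝ E] :
    ((E →L[ℝ] ℝ) →L[ℝ] ℝ) →L[ℝ] E :=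
  ∑ i, (ContinuousLinearMap.apply ℝ ℝ (LinearMap.toContinuousLinearMap
    ((Module.finBasis ℝ E).coord i) : E →L[ℝ] ℝ)).smulRight (Module.finBasis ℝ E i)

theorem apply_bidualL (b : E →L[ℝ] ℝ) (ξ : (E →L[ℝ] ℝ) →L[ℝ] ℝ) : b (bidualL E ξ) = ξ b := by
  have hb : b = ∑ i, b (Module.finBasis ℝ E i) • (LinearMap.toContinuousLinearMap
      ((Module.finBasis ℝ E).coord i) : E →L[ℝ] ℝ) := by
    ext v
    conv_lhs => rw [← (Module.finBasis ℝ E).sum_repr v, map_sum]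
    simp [mul_comm]
  conv_rhs => rw [hb, map_sum]
  simp [bidualL, mul_comm]

/-- The map `P ↦ P♯` on alternating bilinear forms on the dual of `E`. -/
def sharpL (E : Type*) [NormedAddCommGroup E] [NormedSpace ℝ E] [FiniteDimensional ℝ E] :
    ((E →L[ℝ] ℝ) [⋀^Fin 2]→L[ℝ] ℝ) →L[ℝ] ((E →L[ℝ] ℝ) →L[ℝ] E) :=
  (ContinuousLinearMap.compL ℝ (E →L[ℝ] ℝ) ((E →L[ℝ] ℝ) →L[ℝ] ℝ) E (bidualL E)) ∘L
    interiorL (E →L[ℝ] ℝ)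

theorem apply_sharpL (Q : (E →L[ℝ] ℝ) [⋀^Fin 2]→L[ℝ] ℝ) (a b : E →L[ℝ] ℝ) :
    b (sharpL E Q a) = Q ![a, b] := by
  change b (bidualL E (interiorL _ Q a)) = _
  rw [apply_bidualL, interiorL_apply]

omit [FiniteDimensional ℝ E] in
theorem eq_of_forall_dual {u v : E} (h : ∀ b : E →L[ℝ] ℝ, b u = b v) : u = v :=
  (SeparatingDual.eq_iff_forall_dual_eq (R := ℝ)).2 h

/-- The bivector `Q` and the `2`-form `w` on `E` are inverse to each other. -/
structure IsDual (Q : (E →L[ℝ] ℝ) [⋀^Fin 2]→L[ℝ] ℝ) (w : E [⋀^Fin 2]→L[ℝ] ℝ) : Prop where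
  flat_sharp : ∀ a, interiorL E w (sharpL E Q a) = a
  sharp_flat : ∀ u, sharpL E Q (interiorL E w u) = u

theorem IsDual.apply_sharp_left {Q : (E →L[ℝ] ℝ) [⋀^Fin 2]→L[ℝ] ℝ} {w : E [⋀^Fin 2]→L[ℝ] ℝ}
    (h : IsDual Q w) (a : E →L[ℝ] ℝ) (v : E) : w ![sharpL E Q a, v] = a v := by
  rw [← interiorL_apply, h.flat_sharp]

theorem IsDual.apply_sharp_right {Q : (E →L[ℝ] ℝ) [⋀^Fin 2]→L[ℝ] ℝ} {w : E [⋀^Fin 2]→L[ℝ] ℝ}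
    (h : IsDual Q w) (a : E →L[ℝ] ℝ) (v : E) : w ![v, sharpL E Q a] = -a v := by
  rw [apply_swap, h.apply_sharp_left]

theorem IsDual.exists_sharp {Q : (E →L[ℝ] ℝ) [⋀^Fin 2]→L[ℝ] ℝ} {w : E [⋀^Fin 2]→L[ℝ] ℝ}
    (h : IsDual Q w) (u : E) : ∃ a, sharpL E Q a = u := ⟨_, h.sharp_flat u⟩

theorem IsDual.isInvertible {Q : (E →L[ℝ] ℝ) [⋀^Fin 2]→L[ℝ] ℝ} {w : E [⋀^Fin 2]→L[ℝ] ℝ}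
    (h : IsDual Q w) : (sharpL E Q).IsInvertible :=
  .of_inverse (g := interiorL E w) (by ext1 u; exact h.sharp_flat u)
    (by ext1 a; exact h.flat_sharp a)

theorem IsDual.eq_alternatizationL {Q : (E →L[ℝ] ℝ) [⋀^Fin 2]→L[ℝ] ℝ} {w : E [⋀^Fin 2]→L[ℝ] ℝ}
    (h : IsDual Q w) : w = alternatizationL E (sharpL E Q).inverse := by
  have : (sharpL E Q).inverse = interiorL E w :=
    ContinuousLinearMap.inverse_eq (by ext1 u; exact h.sharp_flat u)
      (by ext1 a; exact h.flat_sharp a)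
  rw [this, alternatizationL_interiorL]

theorem exists_isDual {Q : (E →L[ℝ] ℝ) [⋀^Fin 2]→L[ℝ] ℝ}
    (hQ : ∀ a, (∀ b, Q ![a, b] = 0) → a = 0) : ∃ w, IsDual Q w := by
  have hinj : Function.Injective (sharpL E Q : (E →L[ℝ] ℝ) →ₗ[ℝ] E) := by
    refine (injective_iff_map_eq_zero _).2 fun a ha ↦ hQ a fun b ↦ ?_
    rw [← apply_sharpL]
    exact (congrArg b ha).trans (map_zero b)
  have hfr : Module.finrank ℝ (E →L[ℝ] ℝ) = Module.finrank ℝ E := by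
    rw [← (LinearMap.toContinuousLinearMap (𝕜 := ℝ) (E := E) (F' := ℝ)).finrank_eq]
    exact Subspace.dual_finrank_eq
  let e := LinearEquiv.ofInjectiveOfFinrankEq _ hinj hfr
  have he (a) : e a = sharpL E Q a := rfl
  let F : E →L[ℝ] E →L[ℝ] ℝ := LinearMap.toContinuousLinearMap e.symm.toLinearMap
  have hF (a) : F (sharpL E Q a) = a := e.symm_apply_apply a
  have hF' (u) : sharpL E Q (F u) = u := e.apply_symm_apply u
  have hskew (u v : E) : F v u = -F u v := by
    conv_lhs => rw [← hF' u]
    conv_rhs => rw [← hF' v]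
    rw [apply_sharpL, apply_sharpL, apply_swap]
  have hw : interiorL E (alternatizationL E F) = F := by
    ext u v
    rw [interiorL_apply, alternatizationL_apply, hskew u v]
    ring
  exact ⟨alternatizationL E F, by rw [hw]; exact hF, by rw [hw]; exact hF'⟩

end LinearAlgebra

section Calculus

variable {E : Type*} [NormedAddCommGroup E] [NormedSpace ℝ E]

theorem hasFDerivAt_clm_apply {F G : Type*} [NormedAddCommGroup F] [NormedSpace ℝ F]
    [NormedAddCommGroup G] [NormedSpace ℝ G] (L : F →L[ℝ] G) {f : E → F} {f' : E →L[ℝ] F} {y : E}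
    (hf : HasFDerivAt f f' y) : HasFDerivAt (fun z ↦ L (f z)) (L ∘L f') y :=
  L.hasFDerivAt.comp y hf

theorem contDiffOn_clm_apply_of_contDiffOn {F G : Type*} [NormedAddCommGroup F] [NormedSpace ℝ F]
    [NormedAddCommGroup G] [NormedSpace ℝ G] (L : F →L[ℝ] G) {f : E → F} {s : Set E}
    (hf : ContDiffOn ℝ ∞ f s) : ContDiffOn ℝ ∞ (fun z ↦ L (f z)) s :=
  L.contDiff.comp_contDiffOn hf

theorem contDiffOn_inverse {F G : Type*} [NormedAddCommGroup F] [NormedSpace ℝ F]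
    [CompleteSpace F] [NormedAddCommGroup G] [NormedSpace ℝ G] {f : E → F →L[ℝ] G} {s : Set E}
    (hf : ContDiffOn ℝ ∞ f s) (h : ∀ y ∈ s, (f y).IsInvertible) :
    ContDiffOn ℝ ∞ (fun z ↦ (f z).inverse) s := fun y hy ↦
  (h y hy).contDiffAt_map_inverse.comp_contDiffWithinAt y (hf y hy)

theorem fderiv_apply_pair {w : E → E [⋀^Fin 2]→L[ℝ] ℝ} {y : E} (hw : DifferentiableAt ℝ w y)
    {f g : E → E} (hf : DifferentiableAt ℝ f y) (hg : DifferentiableAt ℝ g y) (u : E) :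
    fderiv ℝ (fun z ↦ w z ![f z, g z]) y u =
      fderiv ℝ w y u ![f y, g y] + w y ![fderiv ℝ f y u, g y] + w y ![f y, fderiv ℝ g y u] := by
  have h1 : HasFDerivAt (fun z ↦ interiorL E (w z)) ((interiorL E) ∘L fderiv ℝ w y) y :=
    hasFDerivAt_clm_apply (F := E [⋀^Fin 2]→L[ℝ] ℝ) (G := E →L[ℝ] E →L[ℝ] ℝ) (interiorL E)
      hw.hasFDerivAt
  have h2 := ((h1.clm_apply hf.hasFDerivAt).clm_apply hg.hasFDerivAt).fderiv
  simp only [interiorL_apply] at h2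
  rw [h2]
  simp [interiorL_apply]
  ring

variable [FiniteDimensional ℝ E]

theorem contDiffOn_of_isDual {Q : E → (E →L[ℝ] ℝ) [⋀^Fin 2]→L[ℝ] ℝ} {w : E → E [⋀^Fin 2]→L[ℝ] ℝ}
    {s : Set E} (hQ : ContDiffOn ℝ ∞ Q s) (h : ∀ y ∈ s, IsDual (Q y) (w y)) :
    ContDiffOn ℝ ∞ w s := by
  have hS : ContDiffOn ℝ ∞ (fun y ↦ sharpL E (Q y)) s :=
    contDiffOn_clm_apply_of_contDiffOn (F := (E →L[ℝ] ℝ) [⋀^Fin 2]→L[ℝ] ℝ)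
      (G := (E →L[ℝ] ℝ) →L[ℝ] E) (sharpL E) hQ
  have hinv : ContDiffOn ℝ ∞ (fun y ↦ (sharpL E (Q y)).inverse) s :=
    contDiffOn_inverse (F := E →L[ℝ] ℝ) (G := E) hS fun y hy ↦ (h y hy).isInvertible
  have hd : ContDiffOn ℝ ∞ (fun y ↦ alternatizationL E (sharpL E (Q y)).inverse) s :=
    contDiffOn_clm_apply_of_contDiffOn (F := E →L[ℝ] E →L[ℝ] ℝ) (G := E [⋀^Fin 2]→L[ℝ] ℝ)
      (alternatizationL E) hinv
  exact hd.congr fun y hy ↦ (h y hy).eq_alternatizationL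

theorem IsDual.fderiv_apply_sharp {Q : E → (E →L[ℝ] ℝ) [⋀^Fin 2]→L[ℝ] ℝ}
    {w : E → E [⋀^Fin 2]→L[ℝ] ℝ} {y : E} (h : ∀ᶠ z in nhds y, IsDual (Q z) (w z))
    (hQ : DifferentiableAt ℝ Q y) (hw : DifferentiableAt ℝ w y) (u : E) (a b : E →L[ℝ] ℝ) :
    fderiv ℝ w y u ![sharpL E (Q y) a, sharpL E (Q y) b] = fderiv ℝ Q y u ![a, b] := by
  have hS (a : E →L[ℝ] ℝ) :
      HasFDerivAt (fun z ↦ sharpL E (Q z) a) (((sharpL E) ∘L fderiv ℝ Q y).flip a) y := by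
    have := (hasFDerivAt_clm_apply (F := (E →L[ℝ] ℝ) [⋀^Fin 2]→L[ℝ] ℝ)
        (G := (E →L[ℝ] ℝ) →L[ℝ] E) (sharpL E) hQ.hasFDerivAt).clm_apply
      (hasFDerivAt_const a y)
    simpa using this
  have h1 := fderiv_apply_pair hw (hS a).differentiableAt
    (differentiableAt_const (sharpL E (Q y) b)) u
  have h2 : (fun z ↦ w z ![sharpL E (Q z) a, sharpL E (Q y) b]) =ᶠ[nhds y]
      fun _ ↦ a (sharpL E (Q y) b) := by
    filter_upwards [h] with z hz using hz.apply_sharp_left _ _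
  have hy := h.self_of_nhds
  rw [h2.fderiv_eq, (hS a).fderiv] at h1
  simp only [fderiv_fun_const, Pi.zero_apply, zero_apply,
    ← interiorL_apply, map_zero] at h1
  simp only [ContinuousLinearMap.flip_apply, ContinuousLinearMap.comp_apply] at h1
  simp only [interiorL_apply, hy.apply_sharp_right] at h1
  simp only [apply_sharpL] at h1
  linarith

theorem IsDual.lieDeriv_eq {Q : E → (E →L[ℝ] ℝ) [⋀^Fin 2]→L[ℝ] ℝ}
    {w : E → E [⋀^Fin 2]→L[ℝ] ℝ} {y : E} (h : ∀ᶠ z in nhds y, IsDual (Q z) (w z))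
    (hQ : DifferentiableAt ℝ Q y) (hw : DifferentiableAt ℝ w y) (X : E) (T : E →L[ℝ] E)
    (hL : ∀ a b, fderiv ℝ Q y X ![a, b] - Q y ![a.comp T, b] - Q y ![a, b.comp T] = -Q y ![a, b])
    (u v : E) : fderiv ℝ w y X ![u, v] + w y ![T u, v] + w y ![u, T v] = w y ![u, v] := by
  have hy := h.self_of_nhds
  obtain ⟨a, rfl⟩ := hy.exists_sharp u
  obtain ⟨b, rfl⟩ := hy.exists_sharp v
  have h1 := hL a b
  rw [apply_swap (Q y) b (a.comp T), apply_swap (Q y) b a] at h1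
  rw [IsDual.fderiv_apply_sharp h hQ hw, hy.apply_sharp_right, hy.apply_sharp_left,
    hy.apply_sharp_left]
  simp only [← apply_sharpL, ContinuousLinearMap.comp_apply] at h1 ⊢
  linarith

theorem IsDual.cyclic_fderiv_eq_zero {Q : E → (E →L[ℝ] ℝ) [⋀^Fin 2]→L[ℝ] ℝ}
    {w : E → E [⋀^Fin 2]→L[ℝ] ℝ} {y : E} (h : ∀ᶠ z in nhds y, IsDual (Q z) (w z))
    (hQ : DifferentiableAt ℝ Q y) (hw : DifferentiableAt ℝ w y)
    (hJ : ∀ a b c, fderiv ℝ Q y (sharpL E (Q y) a) ![b, c] +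
      fderiv ℝ Q y (sharpL E (Q y) b) ![c, a] + fderiv ℝ Q y (sharpL E (Q y) c) ![a, b] = 0)
    (u v t : E) : fderiv ℝ w y u ![v, t] + fderiv ℝ w y v ![t, u] + fderiv ℝ w y t ![u, v] = 0 := by
  have hy := h.self_of_nhds
  obtain ⟨a, rfl⟩ := hy.exists_sharp u
  obtain ⟨b, rfl⟩ := hy.exists_sharp v
  obtain ⟨c, rfl⟩ := hy.exists_sharp t
  simpa only [IsDual.fderiv_apply_sharp h hQ hw] using hJ a b c

omit [FiniteDimensional ℝ E] in
theorem extDeriv_two_apply {w : E → E [⋀^Fin 2]→L[ℝ] ℝ} {y : E} (v : Fin 3 → E) :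
    extDeriv w y v = fderiv ℝ w y (v 0) ![v 1, v 2] + fderiv ℝ w y (v 1) ![v 2, v 0] +
      fderiv ℝ w y (v 2) ![v 0, v 1] := by
  have h0 : Fin.removeNth 0 v = ![v 1, v 2] := by
    ext i; fin_cases i <;> rfl
  have h1 : Fin.removeNth 1 v = ![v 0, v 2] := by
    ext i; fin_cases i <;> rfl
  have h2 : Fin.removeNth 2 v = ![v 0, v 1] := by
    ext i; fin_cases i <;> rfl
  rw [extDeriv, ContinuousAlternatingMap.alternatizeUncurryFin_apply, Fin.sum_univ_three,
    h0, h1, h2, apply_swap _ (v 0) (v 2)]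
  simp

omit [FiniteDimensional ℝ E] in
theorem extDeriv_interior_apply {w : E → E [⋀^Fin 2]→L[ℝ] ℝ} {y : E} {X : E → E}
    (hw : DifferentiableAt ℝ w y) (hX : DifferentiableAt ℝ X y)
    (hc : ∀ u v t : E,
      fderiv ℝ w y u ![v, t] + fderiv ℝ w y v ![t, u] + fderiv ℝ w y t ![u, v] = 0)
    (v : Fin 2 → E) :
    extDeriv (fun z ↦ (w z).curryLeft (X z)) y v = fderiv ℝ w y (X y) ![v 0, v 1] +
      w y ![fderiv ℝ X y (v 0), v 1] + w y ![v 0, fderiv ℝ X y (v 1)] := by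
  have hd : DifferentiableAt ℝ (fun z ↦ (w z).curryLeft (X z)) y :=
    (hasFDerivAt_clm_apply (F := E [⋀^Fin 2]→L[ℝ] ℝ) (G := E →L[ℝ] E [⋀^Fin 1]→L[ℝ] ℝ)
      (ContinuousAlternatingMap.curryLeftLI (𝕜 := ℝ) (E := E)
        (F := ℝ) (n := 1)).toContinuousLinearMap hw.hasFDerivAt).differentiableAt.clm_apply hX
  have h0 : Fin.removeNth 0 v = ![v 1] := by
    ext i; fin_cases i; rfl
  have h1 : Fin.removeNth 1 v = ![v 0] := by
    ext i; fin_cases i; rfl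
  rw [extDeriv_apply hd, Fin.sum_univ_two, h0, h1]
  simp only [ContinuousAlternatingMap.curryLeft_apply_apply]
  rw [fderiv_apply_pair hw hX (differentiableAt_const _),
    fderiv_apply_pair hw hX (differentiableAt_const _)]
  have h2 := hc (X y) (v 0) (v 1)
  rw [apply_swap _ (X y) (v 1)] at h2
  rw [apply_swap _ (fderiv ℝ X y (v 1)) (v 0)]
  simp only [fderiv_fun_const, Pi.zero_apply, zero_apply, ← interiorL_apply, map_zero]
  simp only [interiorL_apply]
  simp
  linarith

end Calculus

section ChartCalculus

open Topology

variable {E : Type*} [NormedAddCommGroup E] [NormedSpace ℝ E]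
  {H : Type*} [TopologicalSpace H] {I : ModelWithCorners ℝ E H}
  {M : Type*} [TopologicalSpace M] [ChartedSpace H M]

theorem isInvertible_chartDeriv [IsManifold I ∞ M] {x₀ x : M}
    (hx : x ∈ (extChartAt I x₀).source) : (chartDeriv I x₀ x).IsInvertible :=
  have : IsManifold I 1 M := .of_le (n := ∞) (by norm_num)
  isInvertible_mfderiv_extChartAt hx

theorem chartDeriv_chartSymmDeriv [I.Boundaryless] [IsManifold I ∞ M] {x₀ : M} {y : E}
    (hy : y ∈ (extChartAt I x₀).target) (u : E) :
    chartDeriv I x₀ ((extChartAt I x₀).symm y) (chartSymmDeriv I x₀ y u) = u := by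
  have : IsManifold I 1 M := .of_le (n := ∞) (by norm_num)
  have h := mfderiv_extChartAt_comp_mfderivWithin_extChartAt_symm hy
  rw [I.range_eq_univ, mfderivWithin_univ] at h
  exact congrArg (fun L : E →L[ℝ] E ↦ L u) h

theorem chartSymmDeriv_chartDeriv [I.Boundaryless] [IsManifold I ∞ M] {x₀ : M} {y : E}
    (hy : y ∈ (extChartAt I x₀).target) (v : TangentSpace I ((extChartAt I x₀).symm y)) :
    chartSymmDeriv I x₀ y (chartDeriv I x₀ ((extChartAt I x₀).symm y) v) = v := by
  have : IsManifold I 1 M := .of_le (n := ∞) (by norm_num)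
  have h := mfderivWithin_extChartAt_symm_comp_mfderiv_extChartAt hy
  rw [I.range_eq_univ, mfderivWithin_univ] at h
  exact congrArg (fun L : E →L[ℝ] E ↦ L v) h

theorem formInChart_apply {k : ℕ} (η : DForm I M k) (x₀ : M) (y : E) (u : Fin k → E) :
    formInChart I η x₀ y u = η _ fun i ↦ chartSymmDeriv I x₀ y (u i) := rfl

theorem formInChart_apply_pair (η : DForm I M 2) (x₀ : M) (y u v : E) :
    formInChart I η x₀ y ![u, v] = η _ ![chartSymmDeriv I x₀ y u, chartSymmDeriv I x₀ y v] := by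
  rw [formInChart_apply]
  congr 1
  ext i
  fin_cases i <;> rfl

theorem formInChart_chartDeriv [I.Boundaryless] [IsManifold I ∞ M] {k : ℕ} (η : DForm I M k)
    {x₀ x : M} (hx : x ∈ (extChartAt I x₀).source) (v : Fin k → TangentSpace I x) :
    formInChart I η x₀ (extChartAt I x₀ x) (fun i ↦ chartDeriv I x₀ x (v i)) = η x v := by
  suffices h : ∀ y ∈ (extChartAt I x₀).target, ∀ x, (extChartAt I x₀).symm y = x →
      ∀ v : Fin k → TangentSpace I x,
        formInChart I η x₀ y (fun i ↦ chartDeriv I x₀ x (v i)) = η x v from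
    h _ ((extChartAt I x₀).map_source hx) x ((extChartAt I x₀).left_inv hx) v
  rintro y hy _ rfl v
  rw [formInChart_apply]
  congr 1
  ext i
  exact chartSymmDeriv_chartDeriv hy (v i)

theorem bivectorInChart_apply_pair (P : Bivector I M) (x₀ : M) (y : E) (a b : E →L[ℝ] ℝ) :
    bivectorInChart I P x₀ y ![a, b] = P ((extChartAt I x₀).symm y)
      ![a.comp (chartDeriv I x₀ _), b.comp (chartDeriv I x₀ _)] := by
  change P _ _ = P _ _
  congr 1
  ext1 i
  fin_cases i <;> rfl

theorem bivectorInChart_extChartAt (P : Bivector I M) {x₀ x : M}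
    (hx : x ∈ (extChartAt I x₀).source) (a b : E →L[ℝ] ℝ) :
    bivectorInChart I P x₀ (extChartAt I x₀ x) ![a, b] =
      P x ![a.comp (chartDeriv I x₀ x), b.comp (chartDeriv I x₀ x)] := by
  rw [bivectorInChart_apply_pair, (extChartAt I x₀).left_inv hx]

theorem SmoothVField.contDiffOn_inChart [I.Boundaryless] [IsManifold I ∞ M] {V : VField I M}
    (hV : SmoothVField I V) (x₀ : M) :
    ContDiffOn ℝ ∞ (vfieldInChart I V x₀) (extChartAt I x₀).target := by
  have : IsManifold I 1 M := .of_le (n := ∞) (by norm_num)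
  have h1 : ContMDiffOn I 𝓘(ℝ, E) ∞ (fun x ↦ (chartDeriv I x₀ x (V x) : E))
      (extChartAt I x₀).source := by
    rw [extChartAt_source]
    have h2 : ContMDiffOn I 𝓘(ℝ, E) ∞
        (fun x ↦ (trivializationAt E (TangentSpace I) x₀ ⟨x, V x⟩).2) (chartAt H x₀).source := by
      have := (Bundle.Trivialization.contMDiffOn_section_baseSet_iff
        (trivializationAt E (TangentSpace I : M → Type _) x₀) (IB := I) (n := ∞) (s := V)).1
        (hV.contMDiffOn)
      simpa using this
    refine h2.congr fun x hx ↦ ?_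
    have := TangentBundle.continuousLinearMapAt_trivializationAt (I := I) hx
    rw [chartDeriv, ← this]
    rw [Bundle.Trivialization.continuousLinearMapAt_apply,
      Bundle.Trivialization.coe_linearMapAt_of_mem _ (by simpa using hx)]
  exact (h1.comp (contMDiffOn_extChartAt_symm x₀) fun y hy ↦
    (extChartAt I x₀).map_target hy).contDiffOn

theorem SmoothForm.differentiableAt [I.Boundaryless] {k : ℕ} {η : DForm I M k}
    (h : SmoothForm I η) (x : M) :
    DifferentiableAt ℝ (formInChart I η x) (extChartAt I x x) :=
  ((h x).contDiffAt ((isOpen_extChartAt_target x).mem_nhds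
    (mem_extChartAt_target x))).differentiableAt (by simp)

theorem SmoothBivector.differentiableAt [I.Boundaryless] {P : Bivector I M}
    (h : SmoothBivector I P) (x : M) :
    DifferentiableAt ℝ (bivectorInChart I P x) (extChartAt I x x) :=
  ((h x).contDiffAt ((isOpen_extChartAt_target x).mem_nhds
    (mem_extChartAt_target x))).differentiableAt (by simp)

/-- The contraction `ι_V σ` of a `2`-form with a vector field. -/
def contraction (V : VField I M) (σ : DForm I M 2) : DForm I M 1 := fun x ↦
  ContinuousAlternatingMap.curryLeft (E := E) (σ x) (V x)

theorem formInChart_contraction [I.Boundaryless] [IsManifold I ∞ M] (V : VField I M)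
    (σ : DForm I M 2) {x₀ : M} {y : E} (hy : y ∈ (extChartAt I x₀).target) :
    formInChart I (-contraction V σ) x₀ y =
      -(formInChart I σ x₀ y).curryLeft (vfieldInChart I V x₀ y) := by
  ext u
  change -(σ _ (Matrix.vecCons _ _)) = -(σ _ _)
  congr 2
  ext i
  fin_cases i
  · exact (chartSymmDeriv_chartDeriv hy _).symm
  · rfl

end ChartCalculus

section Duality

open Topology

variable {E : Type*} [NormedAddCommGroup E] [NormedSpace ℝ E] [FiniteDimensional ℝ E]
  {H : Type*} [TopologicalSpace H] {I : ModelWithCorners ℝ E H}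
  {M : Type*} [TopologicalSpace M] [ChartedSpace H M]

omit [FiniteDimensional ℝ E] in
theorem tangent_eq_of_forall_covector {x : M} {u v : TangentSpace I x}
    (h : ∀ b : CotangentSpace I x, b u = b v) : u = v :=
  eq_of_forall_dual (E := E) h

theorem IsAssociated.isDual_inChart [I.Boundaryless] [IsManifold I ∞ M] {P : Bivector I M}
    {σ : DForm I M 2} (h : IsAssociated I P σ) {x₀ : M} {y : E}
    (hy : y ∈ (extChartAt I x₀).target) :
    IsDual (bivectorInChart I P x₀ y) (formInChart I σ x₀ y) := by
  set x := (extChartAt I x₀).symm y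
  let A : TangentSpace I x →L[ℝ] E := chartDeriv I x₀ x
  let B : E →L[ℝ] TangentSpace I x := chartSymmDeriv I x₀ y
  have hAB (u : E) : A (B u) = u := chartDeriv_chartSymmDeriv hy u
  have hBA (v : TangentSpace I x) : B (A v) = v := chartSymmDeriv_chartDeriv hy v
  have hS (a : E →L[ℝ] ℝ) :
      sharpL E (bivectorInChart I P x₀ y) a = A (sharp I P x (a.comp A)) := by
    refine eq_of_forall_dual fun b ↦ ?_
    rw [apply_sharpL, bivectorInChart_apply_pair]
    exact (apply_sharp I P x (a.comp A) (b.comp A)).symm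
  refine ⟨fun a ↦ ?_, fun u ↦ ?_⟩
  · ext v
    rw [interiorL_apply, hS, formInChart_apply_pair]
    change σ x ![B (A (sharp I P x (a.comp A))), B v] = a v
    rw [hBA, ← flat_apply, h.flat_sharp]
    exact congrArg a (hAB v)
  · have hf : (interiorL E (formInChart I σ x₀ y) u).comp A = flat I σ x (B u) := by
      ext v
      rw [flat_apply]
      change interiorL E (formInChart I σ x₀ y) u (A v) = _
      rw [interiorL_apply, formInChart_apply_pair]
      change σ x ![B u, B (A v)] = _
      rw [hBA]
    rw [hS, hf, h.sharp_flat, hAB]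

theorem IsAssociated.unique {P : Bivector I M} {σ τ : DForm I M 2} (hσ : IsAssociated I P σ)
    (hτ : IsAssociated I P τ) : σ = τ := by
  funext x
  refine alternating_ext (E := E) fun u v ↦ ?_
  have h (u : TangentSpace I x) : flat I σ x u = flat I τ x u := by
    conv_lhs => rw [← hτ.sharp_flat x u]
    exact hσ.flat_sharp x _
  exact (flat_apply I σ x u v).symm.trans
    ((congrArg (fun L : E →L[ℝ] ℝ ↦ L v) (h u)).trans (flat_apply I τ x u v))

theorem exists_isAssociated {P : Bivector I M} (hP : BivectorNondegenerate I P) :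
    ∃ σ, IsAssociated I P σ := by
  have h (x : M) : ∃ w : E [⋀^Fin 2]→L[ℝ] ℝ,
      IsDual (E := E) (P x : (E →L[ℝ] ℝ) [⋀^Fin 2]→L[ℝ] ℝ) w := exists_isDual (hP x)
  choose σ hσ using h
  have hsharp (x : M) (α : CotangentSpace I x) : sharp I P x α =
      sharpL E (P x : (E →L[ℝ] ℝ) [⋀^Fin 2]→L[ℝ] ℝ) α := by
    refine tangent_eq_of_forall_covector fun b ↦ ?_
    rw [apply_sharp]
    exact (apply_sharpL (E := E) (P x) α b).symm
  have hflat (x : M) (v : TangentSpace I x) :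
      flat I (fun x ↦ σ x : DForm I M 2) x v = interiorL E (σ x) v := by
    ext w
    exact (flat_apply I (fun x ↦ σ x : DForm I M 2) x v w).trans
      (interiorL_apply (E := E) (σ x) v w).symm
  refine ⟨σ, fun x α ↦ ?_, fun x v ↦ ?_⟩
  · exact (hflat x _).trans ((congrArg (interiorL E (σ x)) (hsharp x α)).trans
      ((hσ x).flat_sharp α))
  · exact (hsharp x _).trans ((congrArg (sharpL E _) (hflat x v)).trans ((hσ x).sharp_flat v))

theorem IsAssociated.smoothForm [I.Boundaryless] [IsManifold I ∞ M] {P : Bivector I M}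
    {σ : DForm I M 2} (h : IsAssociated I P σ) (hP : SmoothBivector I P) : SmoothForm I σ :=
  fun x₀ ↦ contDiffOn_of_isDual (hP x₀) fun _ hy ↦ h.isDual_inChart hy

theorem IsAssociated.nondegenerate {P : Bivector I M} {σ : DForm I M 2} (h : IsAssociated I P σ)
    (x : M) (v : TangentSpace I x) (hv : ∀ w : TangentSpace I x, σ x ![v, w] = 0) : v = 0 := by
  have h0 : flat I σ x v = 0 := by
    ext w
    rw [flat_apply, hv]
    rfl
  rw [← h.sharp_flat x v, h0]
  refine tangent_eq_of_forall_covector fun b ↦ ?_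
  rw [apply_sharp, map_zero]
  exact (P x).map_coord_zero 0 rfl

end Duality

section Jacobi

open Topology

variable {E : Type*} [NormedAddCommGroup E] [NormedSpace ℝ E] [FiniteDimensional ℝ E]
  {H : Type*} [TopologicalSpace H] {I : ModelWithCorners ℝ E H}
  {M : Type*} [TopologicalSpace M] [ChartedSpace H M]

theorem exists_contMDiff_eventuallyEq_chart [T2Space M] [IsManifold I ∞ M] (x : M)
    (a : E →L[ℝ] ℝ) :
    ∃ f : M → ℝ, ContMDiff I 𝓘(ℝ, ℝ) ∞ f ∧ f =ᶠ[𝓝 x] fun z ↦ a (extChartAt I x z) := by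
  let ρ : SmoothBumpFunction I x := Classical.arbitrary _
  refine ⟨fun z ↦ ρ z • a (extChartAt I x z), ρ.contMDiff_smul ?_, ?_⟩
  · exact a.contDiff.contMDiff.comp_contMDiffOn (contMDiffOn_extChartAt (n := ∞))
  · filter_upwards [ρ.eventuallyEq_one] with z hz
    simp [hz]

omit [FiniteDimensional ℝ E] in
theorem differential_comp_extChartAt [IsManifold I ∞ M] {x₀ x : M}
    (hx : x ∈ (extChartAt I x₀).source) {g : E → ℝ}
    (hg : DifferentiableAt ℝ g (extChartAt I x₀ x)) {f : M → ℝ}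
    (hf : f =ᶠ[𝓝 x] fun z ↦ g (extChartAt I x₀ z)) :
    differential I f x = (fderiv ℝ g (extChartAt I x₀ x)).comp (chartDeriv I x₀ x) := by
  have : IsManifold I 1 M := .of_le (n := ∞) (by norm_num)
  rw [differential, hf.mfderiv_eq]
  have h := mfderiv_comp x (I' := 𝓘(ℝ, E)) hg.mdifferentiableAt
    (mdifferentiableAt_extChartAt (I := I) (x := x₀) (by rwa [extChartAt_source] at hx))
  rw [mfderiv_eq_fderiv] at h
  exact h

theorem IsPoisson.jacobi_inChart [T2Space M] [I.Boundaryless] [IsManifold I ∞ M]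
    {P : Bivector I M} (hP : IsPoisson I P) (x : M) (a b c : E →L[ℝ] ℝ) :
    let Q := bivectorInChart I P x
    let y := extChartAt I x x
    fderiv ℝ Q y (sharpL E (Q y) a) ![b, c] + fderiv ℝ Q y (sharpL E (Q y) b) ![c, a] +
      fderiv ℝ Q y (sharpL E (Q y) c) ![a, b] = 0 := by
  intro Q y
  have hQ : DifferentiableAt ℝ Q y := hP.smooth.differentiableAt x
  choose f hf hfa using fun a ↦ exists_contMDiff_eventuallyEq_chart (I := I) x a
  have hd (a : E →L[ℝ] ℝ) :
      ∀ᶠ z in 𝓝 x, differential I (f a) z = a.comp (chartDeriv I x z) := by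
    filter_upwards [(hfa a).eventually_nhds, extChartAt_source_mem_nhds (I := I) x] with z hz hzs
    rw [differential_comp_extChartAt hzs a.differentiableAt hz, a.fderiv]
  have hb (a b : E →L[ℝ] ℝ) :
      bracket I P (f a) (f b) =ᶠ[𝓝 x] fun z ↦ Q (extChartAt I x z) ![a, b] := by
    filter_upwards [hd a, hd b, extChartAt_source_mem_nhds (I := I) x] with z ha hb hzs
    rw [bracket, ha, hb]
    exact (bivectorInChart_extChartAt P hzs a b).symm
  have hbb (a b c : E →L[ℝ] ℝ) : bracket I P (f a) (bracket I P (f b) (f c)) x =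
      fderiv ℝ Q y (sharpL E (Q y) a) ![b, c] := by
    have hQd := hQ.hasFDerivAt.continuousAlternatingMap_apply_const ![b, c]
    rw [bracket, (hd a).self_of_nhds,
      differential_comp_extChartAt (mem_extChartAt_source x) hQd.differentiableAt (hb b c)]
    refine (bivectorInChart_extChartAt P (mem_extChartAt_source x) _ _).symm.trans ?_
    rw [← apply_sharpL, hQd.fderiv]
    rfl
  have := hP.jacobi (f a) (f b) (f c) (hf a) (hf b) (hf c) x
  rwa [hbb, hbb, hbb] at this

end Jacobi

section Main

open Topology

variable {E : Type*} [NormedAddCommGroup E] [NormedSpace ℝ E] [FiniteDimensional ℝ E]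
  {H : Type*} [TopologicalSpace H] {I : ModelWithCorners ℝ E H} [I.Boundaryless]
  {M : Type*} [TopologicalSpace M] [ChartedSpace H M] [IsManifold I ∞ M]

theorem IsAssociated.eventually_isDual {P : Bivector I M} {σ : DForm I M 2}
    (h : IsAssociated I P σ) (x : M) : ∀ᶠ z in 𝓝 (extChartAt I x x),
      IsDual (bivectorInChart I P x z) (formInChart I σ x z) := by
  filter_upwards [(isOpen_extChartAt_target (I := I) x).mem_nhds (mem_extChartAt_target x)]
    with z hz using h.isDual_inChart hz

theorem IsAssociated.cyclic_fderiv [T2Space M] {P : Bivector I M} {σ : DForm I M 2}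
    (h : IsAssociated I P σ) (hP : IsPoisson I P) (x : M) (u v t : E) :
    fderiv ℝ (formInChart I σ x) (extChartAt I x x) u ![v, t] +
      fderiv ℝ (formInChart I σ x) (extChartAt I x x) v ![t, u] +
      fderiv ℝ (formInChart I σ x) (extChartAt I x x) t ![u, v] = 0 :=
  IsDual.cyclic_fderiv_eq_zero (h.eventually_isDual x)
    (hP.smooth.differentiableAt x) ((h.smoothForm hP.smooth).differentiableAt x)
    (hP.jacobi_inChart x) u v t

theorem IsAssociated.lieDeriv_inChart {P : Bivector I M} {D : VField I M} {σ : DForm I M 2}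
    (h : IsAssociated I P σ) (hP : IsExactPoisson I P D) (x : M) (u v : E) :
    let y := extChartAt I x x
    let w := formInChart I σ x
    let X := vfieldInChart I D x
    fderiv ℝ w y (X y) ![u, v] + w y ![fderiv ℝ X y u, v] + w y ![u, fderiv ℝ X y v] =
      w y ![u, v] := by
  intro y w X
  refine IsDual.lieDeriv_eq (h.eventually_isDual x)
    (hP.poisson.smooth.differentiableAt x)
    ((h.smoothForm hP.poisson.smooth).differentiableAt x) _ _ (fun a b ↦ ?_) u v
  have hc (a : E →L[ℝ] ℝ) : covectorInChart I x (a.comp (chartDeriv I x x)) = a := by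
    have hi := (isInvertible_chartDeriv (I := I) (mem_extChartAt_source x))
    ext v
    exact congrArg a (hi.self_apply_inverse v)
  have hL := hP.lieDeriv x (a.comp (chartDeriv I x x)) (b.comp (chartDeriv I x x))
  rw [← bivectorInChart_extChartAt P (mem_extChartAt_source x)] at hL
  simp only [lieDerivBivector, hc] at hL
  exact hL

theorem IsAssociated.lieDerivForm_eq {P : Bivector I M} {D : VField I M} {σ : DForm I M 2}
    (h : IsAssociated I P σ) (hP : IsExactPoisson I P D) (x : M)
    (v : Fin 2 → TangentSpace I x) : lieDerivForm I D σ x v = σ x v := by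
  rw [← formInChart_chartDeriv σ (mem_extChartAt_source x) v]
  have hL := h.lieDeriv_inChart hP x (chartDeriv I x x (v 0)) (chartDeriv I x x (v 1))
  have hu : (fun i ↦ chartDeriv I x x (v i) : Fin 2 → E) =
      ![chartDeriv I x x (v 0), chartDeriv I x x (v 1)] := by
    ext i
    fin_cases i <;> rfl
  simp only [lieDerivForm, Fin.sum_univ_two]
  rw [hu]
  refine Eq.trans ?_ hL
  rw [add_assoc]
  congr 3
  · ext i
    fin_cases i <;> rfl
  · ext i
    fin_cases i <;> rfl

theorem IsAssociated.isExactSymplectic [T2Space M] {P : Bivector I M} {D : VField I M}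
    {σ : DForm I M 2} (h : IsAssociated I P σ) (hP : IsExactPoisson I P D) :
    IsExactSymplectic I σ := by
  have hσ := h.smoothForm hP.poisson.smooth
  refine ⟨⟨hσ, ?_, h.nondegenerate⟩, -contraction D σ, fun x₀ ↦ ?_, ?_⟩
  · funext x
    have : extDeriv (formInChart I σ x) (extChartAt I x x) = 0 := by
      ext v
      rw [extDeriv_two_apply, h.cyclic_fderiv hP.poisson]
      rfl
    rw [dExt, this]
    rfl
  · refine ContDiffOn.congr ?_ fun y hy ↦ formInChart_contraction D σ hy
    refine ContDiffOn.neg (ContDiffOn.clm_apply ?_ (hP.smooth.contDiffOn_inChart x₀))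
    exact contDiffOn_clm_apply_of_contDiffOn (F := E [⋀^Fin 2]→L[ℝ] ℝ)
      (G := E →L[ℝ] E [⋀^Fin 1]→L[ℝ] ℝ) (ContinuousAlternatingMap.curryLeftLI (𝕜 := ℝ) (E := E)
        (F := ℝ) (n := 1)).toContinuousLinearMap (hσ x₀)
  · funext x
    have ht := (isOpen_extChartAt_target (I := I) x).mem_nhds (mem_extChartAt_target x)
    have hX : DifferentiableAt ℝ (vfieldInChart I D x) (extChartAt I x x) :=
      ((hP.smooth.contDiffOn_inChart x).contDiffAt ht).differentiableAt (by simp)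
    have hE : extDeriv (formInChart I (-contraction D σ) x) (extChartAt I x x) =
        -formInChart I σ x (extChartAt I x x) := by
      have he : formInChart I (-contraction D σ) x =ᶠ[𝓝 (extChartAt I x x)]
          (-1 : ℝ) • fun z ↦ (formInChart I σ x z).curryLeft (vfieldInChart I D x z) := by
        filter_upwards [ht] with z hz
        rw [formInChart_contraction D σ hz]
        simp
      rw [he.extDeriv_eq, extDeriv_smul]
      ext v
      have hv : v = ![v 0, v 1] := by
        ext i
        fin_cases i <;> rfl
      have hi := extDeriv_interior_apply (hσ.differentiableAt x) hX (h.cyclic_fderiv hP.poisson x) v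
      rw [h.lieDeriv_inChart hP x, ← hv] at hi
      rw [ContinuousAlternatingMap.smul_apply, ContinuousAlternatingMap.neg_apply, hi, neg_one_smul]
    ext v
    rw [← formInChart_chartDeriv σ (mem_extChartAt_source x) v]
    change _ = -(extDeriv (formInChart I (-contraction D σ) x) (extChartAt I x x)
      fun i ↦ chartDeriv I x x (v i))
    rw [hE]
    simp

end Main

end ExactPoisson
end

theorem mainTheorem9
    {E : Type*} [NormedAddCommGroup E] [NormedSpace ℝ E] [FiniteDimensional ℝ E]
    {H : Type*} [TopologicalSpace H] (I : ModelWithCorners ℝ E H) [I.Boundaryless]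
    {M : Type*} [TopologicalSpace M] [T2Space M] [ChartedSpace H M] [IsManifold I ∞ M]
    (P : ExactPoisson.Bivector I M) (D : ExactPoisson.VField I M)
    (hPD : ExactPoisson.IsExactPoisson I P D)
    (hP : ExactPoisson.BivectorNondegenerate I P) :
    (∃! σ : ExactPoisson.DForm I M 2, ExactPoisson.IsAssociated I P σ) ∧
      ∀ σ : ExactPoisson.DForm I M 2, ExactPoisson.IsAssociated I P σ →
        (∀ (x : M) (v : Fin 2 → TangentSpace I x),
          ExactPoisson.lieDerivForm I D σ x v = σ x v) ∧
        ExactPoisson.IsExactSymplectic I σ := by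
  obtain ⟨σ, hσ⟩ := ExactPoisson.exists_isAssociated hP
  exact ⟨⟨σ, hσ, fun τ hτ ↦ hτ.unique hσ⟩,
    fun τ hτ ↦ ⟨hτ.lieDerivForm_eq hPD, hτ.isExactSymplectic hPD⟩⟩
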